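/- **Setting.** Let $k\ge 1$ and $\mathbf n=(n_1,\dots,n_k)$ with $n_i\ge 1$. For a complex Hilbert space $\mathcal H$ let $\mathbf B_{\mathbf n}(\mathcal H)$ (the regular polyball) be the set of all tuples $\mathbf X=(X_{i,j})_{1\le i\le k,\,1\le j\le n_i}$ in $B(\mathcal H)$ such that every $X_{s,a}$ commutes with every $X_{t,b}$ for $s\ne t$, $\|\sum_j X_{i,j}X_{i,j}^*\|^{1/2}<1$ for each $i$, and the operator $(\mathrm{id}-\Phi_{X_1})\circ\cdots\circ(\mathrm{id}-\Phi_{X_k})(I)$ is positive and invertible, where $\Phi_{X_i}(Y)=\sum_j X_{i,j}YX_{i,j}^*$. Let $\mathbf B_{\mathbf n}(\mathcal H)^-$ be its norm closure. Let $\mathbb F_{n}^+$ be the free monoid on $n$ generators. For $\boldsymbol\alpha=(\alpha_1,\dots,\alpha_k)\in\mathbb F_{n_1}^+\times\cdots\times\mathbb F_{n_k}^+$ put $\mathbf X_{\boldsymbol\alpha}=X_{1,\alpha_1}\cdots X_{k,\alpha_k}$, where $X_{i,\alpha_i}=X_{i,j_1}\cdots X_{i,j_p}$ if $\alpha_i=g_{j_1}\cdots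 g_{j_p}$ (and $I$ for the empty word), and for $\mathbf p\in\mathbb Z_+^k$ let $\Lambda_{\mathbf p}=\{\boldsymbol\alpha:\ |\alpha_i|=p_i \text{ for all } i\}$. A free holomorphic function $F$ with coefficients $A_{(\boldsymbol\alpha)}\in B(\mathcal K)$ is a formal series such that $$F(\mathbf X)=\sum_{\mathbf p\in\mathbb Z_+^k}\ \sum_{\boldsymbol\alpha\in\Lambda_{\mathbf p}}A_{(\boldsymbol\alpha)}\otimes\mathbf X_{\boldsymbol\alpha}\in B(\mathcal K\otimes\mathcal H)$$ converges in operator norm for every Hilbert space $\mathcal H$ and every $\mathbf X\in\mathbf B_{\mathbf n}(\mathcal H)$. It is bounded if $\|F\|_\infty:=\sup\|F(\mathbf X)\|<\infty$, the supremum being over all $\mathcal H$ and all $\mathbf X\in\mathbf B_{\mathbf n}(\mathcal H)$. With scalar coefficients one has $\varphi(\mathbf X)=\sum_{\mathbf p}\sum_{\boldsymbol\alpha\in\Lambda_{\mathbf p}}a_{(\boldsymbol\alpha)}\mathbf X_{\boldsymbol\alpha}\in B(\mathcal H)$, and $H^\infty(\mathbf B_{\mathbf n})$ is the set of bounded free holomorphic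 functions with scalar coefficients. The Bohr radius $K_{mh}(\mathbf B_{\mathbf n})$ is the largest $r\ge 0$ such that $$\sum_{\mathbf p\in\mathbb Z_+^k}\Big\|\sum_{\boldsymbol\alpha\in\Lambda_{\mathbf p}}a_{(\boldsymbol\alpha)}\mathbf X_{\boldsymbol\alpha}\Big\|\le\|\varphi\|_\infty$$ for all $\varphi\in H^\infty(\mathbf B_{\mathbf n})$, all Hilbert spaces $\mathcal H$ and all $\mathbf X\in r\mathbf B_{\mathbf n}(\mathcal H)^-$. **Theorem.** (i) Let $\mathcal K\neq\{0\}$ be a complex Hilbert space and $F$ a bounded free holomorphic function with coefficients $A_{(\boldsymbol\alpha)}\in B(\mathcal K)$ such that $\|F\|_\infty\le 1$ and $F(0)=a_0I$ for some $a_0\in\mathbb C$. Let $r_1,\dots,r_k\in[0,1)$. Then for every Hilbert space $\mathcal H$ and every $\mathbf X=(r_iY_{i,j})$ with $(Y_{i,j})\in\mathbf B_{\mathbf n}(\mathcal H)^-$, $$\sum_{\mathbf p\in\mathbb Z_+^k}\Big\|\sum_{\boldsymbol\alpha\in\Lambda_{\mathbf p}}A_{(\boldsymbol\alpha)}\otimes\mathbf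 X_{\boldsymbol\alpha}\Big\|\le|a_0|+(1-|a_0|^2)\Big[\prod_{i=1}^k(1-r_i)^{-1}-1\Big].$$ Consequently, if $\prod_{i=1}^k(1-r_i)\ge\frac23$, the left-hand side is at most $1$. (ii) The Bohr radius exists (the largest such $r$ is attained) and $$1-\left(\tfrac23\right)^{1/k}\le K_{mh}(\mathbf B_{\mathbf n})\le\tfrac13.$$ -/

import Mathlib

open scoped TensorProduct

universe u v

namespace Polyball

noncomputable section

/-- Multi-words: elements `α = (α₁, …, α_k)` of the product `𝔽⁺_{n₁} × ⋯ × 𝔽⁺_{n_k}` of free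
monoids on `n₁, …, n_k` generators. -/
abbrev MultiWord {k : ℕ} (n : Fin k → ℕ) : Type :=
  ∀ i : Fin k, FreeMonoid (Fin (n i))

/-- `Λ_p`: the multi-words `α` with `|α_i| = p_i` for every `i`. -/
def multiWordsOfDegree {k : ℕ} (n : Fin k → ℕ) (p : Fin k → ℕ) : Set (MultiWord n) :=
  {α | ∀ i, (α i).length = p i}

theorem finite_multiWordsOfDegree {k : ℕ} (n : Fin k → ℕ) (p : Fin k → ℕ) :
    (multiWordsOfDegree n p).Finite := by
  exact Set.Finite.pi' fun i => List.finite_length_eq (Fin (n i)) (p i)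

/-- The finite set `Λ_p` as a `Finset`. -/
def multiWordsFinset {k : ℕ} (n : Fin k → ℕ) (p : Fin k → ℕ) : Finset (MultiWord n) :=
  (finite_multiWordsOfDegree n p).toFinset

/-- Tuples `X = (X_{i,j})`, `1 ≤ i ≤ k`, `1 ≤ j ≤ n_i`, of bounded operators on `H`. -/
abbrev OpTuple {k : ℕ} (n : Fin k → ℕ) (H : Type v) [NormedAddCommGroup H]
    [InnerProductSpace ℂ H] : Type v :=
  ∀ i : Fin k, Fin (n i) → (H →L[ℂ] H)

section Operators

variable {k : ℕ} {n : Fin k → ℕ} {H : Type v} [NormedAddCommGroup H] [InnerProductSpace ℂ H]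

/-- `X_α = X_{1,α₁} ⋯ X_{k,α_k}`, where `X_{i,α_i} = X_{i,j₁} ⋯ X_{i,j_p}` for
`α_i = g_{j₁} ⋯ g_{j_p}`, and `X_{i,g₀} = I`. -/
def wordEval (X : OpTuple n H) (α : MultiWord n) : H →L[ℂ] H :=
  (List.ofFn fun i : Fin k => FreeMonoid.lift (X i) (α i)).prod

/-- The scaled tuple `r X = (r_i X_{i,j})`. -/
def scale (r : Fin k → ℝ) (X : OpTuple n H) : OpTuple n H :=
  fun i j => (r i : ℂ) • X i j

variable [CompleteSpace H]

/-- The completely positive map `Φ_T(Y) = ∑_j T_j Y T_j^*` on `B(H)` of a row `T = (T_1, …, T_m)`. -/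
def rowMap {m : ℕ} (T : Fin m → (H →L[ℂ] H)) : Module.End ℂ (H →L[ℂ] H) :=
  ∑ j, LinearMap.mulLeft ℂ (T j) * LinearMap.mulRight ℂ (ContinuousLinearMap.adjoint (T j))

theorem rowMap_apply {m : ℕ} (T : Fin m → (H →L[ℂ] H)) (Y : H →L[ℂ] H) :
    rowMap T Y = ∑ j, T j * Y * ContinuousLinearMap.adjoint (T j) := by
  simp [rowMap, LinearMap.sum_apply, mul_assoc]

/-- The defect mapping `Δ_X = (id - Φ_{X_1}) ∘ ⋯ ∘ (id - Φ_{X_k})`. -/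
def defectMap (X : OpTuple n H) : Module.End ℂ (H →L[ℂ] H) :=
  (List.ofFn fun i : Fin k => 1 - rowMap (X i)).prod

/-- The regular polyball `B_n(H)`: tuples `X` such that entries of `X_s` and `X_t` commute for
`s ≠ t`, each row satisfies `‖∑_j X_{i,j} X_{i,j}^*‖^{1/2} < 1`, and the defect operator
`Δ_X(I)` is positive and invertible. -/
def regularPolyball (n : Fin k → ℕ) (H : Type v) [NormedAddCommGroup H] [InnerProductSpace ℂ H]
    [CompleteSpace H] : Set (OpTuple n H) :=
  {X | (∀ s t, s ≠ t → ∀ a b, Commute (X s a) (X t b)) ∧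
    (∀ i, √‖∑ j, X i j * ContinuousLinearMap.adjoint (X i j)‖ < 1) ∧
    (defectMap X 1).IsPositive ∧ IsUnit (defectMap X 1)}

/-- `ρ B_n(H)^-`: the image of the norm closure of the regular polyball under scaling by `r`. -/
def scaledClosedPolyball (n : Fin k → ℕ) (H : Type v) [NormedAddCommGroup H]
    [InnerProductSpace ℂ H] [CompleteSpace H] (r : Fin k → ℝ) : Set (OpTuple n H) :=
  scale r '' closure (regularPolyball n H)

end Operators

section OperatorCoefficients

/-- The Hilbert space tensor product `K ⊗ H`. -/
abbrev HilbertTensor (K : Type u) [NormedAddCommGroup K] [InnerProductSpace ℂ K]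
    (H : Type v) [NormedAddCommGroup H] [InnerProductSpace ℂ H] : Type (max u v) :=
  UniformSpace.Completion (K ⊗[ℂ] H)

variable {k : ℕ} {n : Fin k → ℕ} {K : Type u} [NormedAddCommGroup K] [InnerProductSpace ℂ K]

/-- The operator `A ⊗ X` on `K ⊗ H`, determined by `(A ⊗ X)(x ⊗ h) = A x ⊗ X h`. -/
def opTensor {H : Type v} [NormedAddCommGroup H] [InnerProductSpace ℂ H]
    (A : K →L[ℂ] K) (X : H →L[ℂ] H) : HilbertTensor K H →L[ℂ] HilbertTensor K H :=
  (TensorProduct.mapL A X).completion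

/-- The multi-homogeneous part `∑_{α ∈ Λ_p} A_α ⊗ X_α`. -/
def homPart {H : Type v} [NormedAddCommGroup H] [InnerProductSpace ℂ H]
    (A : MultiWord n → (K →L[ℂ] K)) (X : OpTuple n H) (p : Fin k → ℕ) :
    HilbertTensor K H →L[ℂ] HilbertTensor K H :=
  ∑ α ∈ multiWordsFinset n p, opTensor (A α) (wordEval X α)

/-- The value `F(X) = ∑_p ∑_{α ∈ Λ_p} A_α ⊗ X_α` (sum in the operator norm topology). -/
def value {H : Type v} [NormedAddCommGroup H] [InnerProductSpace ℂ H]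
    (A : MultiWord n → (K →L[ℂ] K)) (X : OpTuple n H) :
    HilbertTensor K H →L[ℂ] HilbertTensor K H :=
  ∑' p : Fin k → ℕ, homPart A X p

/-- The formal power series `F = ∑_α A_α ⊗ Z_α` with coefficients in `B(K)` is a free holomorphic
function on the regular polyball: its multi-homogeneous expansion converges in the operator norm at
every `X ∈ B_n(H)`, for every Hilbert space `H`. -/
def IsFreeHolomorphic (A : MultiWord n → (K →L[ℂ] K)) : Prop :=
  ∀ (H : Type v) [NormedAddCommGroup H] [InnerProductSpace ℂ H] [CompleteSpace H],
    ∀ X ∈ regularPolyball n H, Summable fun p : Fin k → ℕ => homPart A X p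

/-- The set of all norms `‖F(X)‖`, for `X ∈ B_n(H)` and `H` a Hilbert space. -/
def normValues (A : MultiWord n → (K →L[ℂ] K)) : Set ℝ :=
  {c | ∃ (H : Type v) (_ : NormedAddCommGroup H) (_ : InnerProductSpace ℂ H) (_ : CompleteSpace H),
    ∃ X ∈ regularPolyball n H, c = ‖value A X‖}

/-- `F` is a bounded free holomorphic function on the regular polyball. -/
def IsBoundedFreeHolomorphic (A : MultiWord n → (K →L[ℂ] K)) : Prop :=
  IsFreeHolomorphic.{u, v} A ∧ BddAbove (normValues.{u, v} A)

/-- `‖F‖_∞`: the supremum of `‖F(X)‖` over all `X ∈ B_n(H)` and all Hilbert spaces `H`. -/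
def supNorm (A : MultiWord n → (K →L[ℂ] K)) : ℝ :=
  sSup (normValues.{u, v} A)

end OperatorCoefficients

section ScalarCoefficients

variable {k : ℕ} {n : Fin k → ℕ}

/-- The multi-homogeneous part `∑_{α ∈ Λ_p} a_α X_α`, for scalar coefficients. -/
def scalarHomPart {H : Type v} [NormedAddCommGroup H] [InnerProductSpace ℂ H]
    (a : MultiWord n → ℂ) (X : OpTuple n H) (p : Fin k → ℕ) : H →L[ℂ] H :=
  ∑ α ∈ multiWordsFinset n p, a α • wordEval X α

/-- The value `φ(X) = ∑_p ∑_{α ∈ Λ_p} a_α X_α` (sum in the operator norm topology). -/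
def scalarValue {H : Type v} [NormedAddCommGroup H] [InnerProductSpace ℂ H]
    (a : MultiWord n → ℂ) (X : OpTuple n H) : H →L[ℂ] H :=
  ∑' p : Fin k → ℕ, scalarHomPart a X p

/-- The set of all norms `‖φ(X)‖`, for `X ∈ B_n(H)` and `H` a Hilbert space. -/
def scalarNormValues (a : MultiWord n → ℂ) : Set ℝ :=
  {c | ∃ (H : Type v) (_ : NormedAddCommGroup H) (_ : InnerProductSpace ℂ H) (_ : CompleteSpace H),
    ∃ X ∈ regularPolyball n H, c = ‖scalarValue a X‖}

/-- The Hardy space `H^∞(B_n)` of bounded free holomorphic functions with scalar coefficients,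
each function being given by its coefficients. -/
def hardySpace (n : Fin k → ℕ) : Set (MultiWord n → ℂ) :=
  {a | (∀ (H : Type v) [NormedAddCommGroup H] [InnerProductSpace ℂ H] [CompleteSpace H],
      ∀ X ∈ regularPolyball n H, Summable fun p : Fin k → ℕ => scalarHomPart a X p) ∧
    BddAbove (scalarNormValues.{v} a)}

/-- `‖φ‖_∞` for scalar coefficients. -/
def scalarSupNorm (a : MultiWord n → ℂ) : ℝ :=
  sSup (scalarNormValues.{v} a)

/-- The set of `r ≥ 0` such that `∑_p ‖∑_{α ∈ Λ_p} a_α X_α‖ ≤ ‖φ‖_∞` for all `φ ∈ H^∞(B_n)` and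
all `X ∈ r B_n(H)^-`, `H` a Hilbert space. -/
def bohrSet (n : Fin k → ℕ) : Set ℝ :=
  {r | 0 ≤ r ∧ ∀ a ∈ hardySpace.{v} n,
    ∀ (H : Type v) [NormedAddCommGroup H] [InnerProductSpace ℂ H] [CompleteSpace H],
      ∀ X ∈ scaledClosedPolyball n H (fun _ => r),
        Summable (fun p : Fin k → ℕ => ‖scalarHomPart a X p‖) ∧
          ∑' p : Fin k → ℕ, ‖scalarHomPart a X p‖ ≤ scalarSupNorm.{v} a}

/-- The Bohr radius `K_mh(B_n)` for multi-homogeneous expansions: the largest element of the set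
above. -/
def bohrRadius (n : Fin k → ℕ) : ℝ :=
  sSup (bohrSet.{v} n)

end ScalarCoefficients

end

end Polyball

/-!
Why the Bohr inequality holds. If `X` lies in the regular polyball, so does every tuple
`(z_i X_{i,j})` with `|z_i| = 1` (`twist_mem_regularPolyball`), and the value of the function there
is `∑_p z^p F_p(X)`, where `F_p` is the `p`-th multi-homogeneous part. So a bounded free holomorphic
function yields, for each `X`, an operator-valued Fourier series on the torus `𝕋^k` with
frequencies in `ℤ_+^k` only, bounded by `M`, with constant term `a₀ I`. Averaging its
quadratic form on the trigonometric polynomials `u₀ + z^p u₁`, `v₀ + z^p v₁` shows that the block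
`[[a₀, 0], [F_p(X), a₀]]` has norm at most `M` (`two_mul_re_inner_toeplitz_le`). A suitable choice
of the vectors then gives the Wiener inequality `M ‖F_p(X)‖ ≤ M² - |a₀|²` for `p ≠ 0`
(`mul_norm_coeff_le`), and it extends to the closed polyball by continuity. Only scalar series
occur under the integral, and these converge absolutely, so unconditional convergence in operator
norm is all that is needed. Since `F_p(rY) = r^p F_p(Y)`, summing a multiple geometric series proves
the first part, and the lower bound for the Bohr radius follows from the scalar version with `M`
decreasing to `‖φ‖_∞`.

For the upper bound, the Möbius function `(c - z) / (1 - c z)` is evaluated at the single entry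
`X_{i,j}`, a strict contraction. It is bounded by `1` by a direct case of von Neumann's inequality
(`exists_hasSum_moebius`), and at scalar tuples the inequality defining the Bohr radius becomes
`c + (1 - c²) r / (1 - c r) ≤ 1`, which fails for `c` near `1` as soon as `r > 1/3`. The supremum is
attained because the finite partial sums of `∑_p r^{|p|} ‖φ_p(Y)‖` are continuous in `r`
(`csSup_bohrSet_mem`).
-/

namespace Polyball

open MeasureTheory UnitAddTorus UniformSpace
open scoped ComplexOrder

/-! ### Means over the torus -/

/-- The normalised Haar measure of the torus `(ℝ / ℤ)^k`. -/
noncomputable def torusHaar (k : ℕ) : Measure (UnitAddTorus (Fin k)) :=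
  Measure.pi fun _ => AddCircle.haarAddCircle

instance (k : ℕ) : IsProbabilityMeasure (torusHaar k) := by
  unfold torusHaar; infer_instance

/-- `f` is integrable over the torus, with integral `c`. -/
def HasMean {k : ℕ} (f : UnitAddTorus (Fin k) → ℂ) (c : ℂ) : Prop :=
  Integrable f (torusHaar k) ∧ ∫ t, f t ∂torusHaar k = c

theorem HasMean.add {k : ℕ} {f g : UnitAddTorus (Fin k) → ℂ} {a b : ℂ} (hf : HasMean f a)
    (hg : HasMean g b) : HasMean (fun t => f t + g t) (a + b) :=
  ⟨hf.1.add hg.1, by rw [integral_add hf.1 hg.1, hf.2, hg.2]⟩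

theorem HasMean.const_mul {k : ℕ} {f : UnitAddTorus (Fin k) → ℂ} {a : ℂ} (c : ℂ)
    (hf : HasMean f a) : HasMean (fun t => c * f t) (c * a) :=
  ⟨hf.1.const_mul c, by rw [integral_const_mul, hf.2]⟩

theorem hasMean_const {k : ℕ} (c : ℂ) : HasMean (fun _ : UnitAddTorus (Fin k) => c) c :=
  ⟨integrable_const c, by simp⟩

theorem HasMean.re_nonneg {k : ℕ} {f : UnitAddTorus (Fin k) → ℂ} {a : ℂ} (hf : HasMean f a)
    (h : ∀ t, 0 ≤ (f t).re) : 0 ≤ a.re := by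
  have h1 : ∫ t, (f t).re ∂torusHaar k = (∫ t, f t ∂torusHaar k).re := integral_re hf.1
  rw [← hf.2, ← h1]
  exact integral_nonneg h

theorem integrable_of_continuous {k : ℕ} {f : UnitAddTorus (Fin k) → ℂ} (hf : Continuous f) :
    Integrable f (torusHaar k) :=
  hf.integrable_of_hasCompactSupport (HasCompactSupport.of_compactSpace f)

theorem integral_fourier (m : ℤ) :
    ∫ t : UnitAddCircle, fourier m t ∂AddCircle.haarAddCircle = if m = 0 then 1 else 0 := by
  split_ifs with h
  · simp [h]
  · exact integral_eq_zero_of_add_right_eq_neg (μ := AddCircle.haarAddCircle)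
      (fourier_add_half_inv_index h (by norm_num))

theorem hasMean_mFourier {k : ℕ} (m : Fin k → ℤ) :
    HasMean (fun t => mFourier m t) (if m = 0 then 1 else 0) := by
  refine ⟨integrable_of_continuous (mFourier m).continuous, ?_⟩
  simp only [mFourier, ContinuousMap.coe_mk, torusHaar]
  rw [integral_fintype_prod_eq_prod (fun i t => fourier (m i) t)]
  simp only [integral_fourier]
  split_ifs with h
  · simp [h]
  · obtain ⟨i, hi⟩ := Function.ne_iff.mp h
    exact Finset.prod_eq_zero (Finset.mem_univ i) (if_neg hi)

theorem norm_mFourier_apply {k : ℕ} (m : Fin k → ℤ) (t : UnitAddTorus (Fin k)) :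
    ‖mFourier m t‖ = 1 := by
  simp only [mFourier, ContinuousMap.coe_mk, norm_prod, fourier_apply]
  exact Finset.prod_eq_one fun _ _ => Circle.norm_coe _

/-- The character `t ↦ z^p`, `z_i = exp (2π i t_i)`, for a multi-degree `p`. -/
noncomputable def torusMonomial {k : ℕ} (p : Fin k → ℕ) (t : UnitAddTorus (Fin k)) : ℂ :=
  mFourier (fun i => (p i : ℤ)) t

/-- Termwise integration of an absolutely convergent power series times a character: the mean picks
out the coefficient of `z^{-m}`. -/
theorem hasMean_tsum {k : ℕ} {c : (Fin k → ℕ) → ℂ} (hc : Summable fun q => ‖c q‖)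
    (m : Fin k → ℤ) :
    HasMean (fun t => (∑' q, torusMonomial q t * c q) * mFourier m t)
      (∑' q, c q * if (fun i => (q i : ℤ)) + m = 0 then 1 else 0) := by
  have hcont : Continuous fun t : UnitAddTorus (Fin k) => ∑' q, torusMonomial q t * c q :=
    continuous_tsum (fun q => (mFourier _).continuous.mul continuous_const) hc
      fun q t => by simp [torusMonomial, norm_mFourier_apply]
  refine ⟨integrable_of_continuous (hcont.mul (mFourier m).continuous), ?_⟩
  have key := fun q : Fin k → ℕ =>
    (hasMean_mFourier ((fun i => (q i : ℤ)) + m)).const_mul (c q)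
  have h := hasSum_integral_of_summable_integral_norm (fun q => (key q).1)
    (by simpa [norm_mFourier_apply] using hc)
  calc _ = ∫ t, ∑' q, c q * mFourier ((fun i => (q i : ℤ)) + m) t ∂torusHaar k := by
        refine integral_congr_ae (.of_forall fun t => ?_)
        simp only [← tsum_mul_right, torusMonomial, mFourier_add]
        exact tsum_congr fun q => by ring
    _ = _ := by rw [← h.tsum_eq]; exact tsum_congr fun q => (key q).2

theorem hasMean_tsum_zero {k : ℕ} {c : (Fin k → ℕ) → ℂ} (hc : Summable fun q => ‖c q‖) :
    HasMean (fun t => ∑' q, torusMonomial q t * c q) (c 0) := by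
  convert! hasMean_tsum hc 0 using 1
  · simp [mFourier_zero]
  · rw [tsum_eq_single 0]
    · rw [if_pos, mul_one]
      ext; simp
    · intro q hq
      rw [if_neg, mul_zero]
      exact fun h => hq (funext fun i => by simpa using congrFun h i)

theorem hasMean_tsum_mul {k : ℕ} {c : (Fin k → ℕ) → ℂ} (hc : Summable fun q => ‖c q‖)
    {p : Fin k → ℕ} (hp : p ≠ 0) :
    HasMean (fun t => (∑' q, torusMonomial q t * c q) * torusMonomial p t) 0 := by
  convert! hasMean_tsum hc (fun i => (p i : ℤ)) using 1
  refine ((tsum_congr fun q => ?_).trans tsum_zero).symm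
  rw [if_neg, mul_zero]
  refine fun h => hp (funext fun i => ?_)
  have := congrFun h i
  simp only [Pi.add_apply, Pi.zero_apply] at this ⊢
  omega

theorem hasMean_tsum_mul_conj {k : ℕ} {c : (Fin k → ℕ) → ℂ} (hc : Summable fun q => ‖c q‖)
    (p : Fin k → ℕ) :
    HasMean (fun t => (∑' q, torusMonomial q t * c q) * star (torusMonomial p t)) (c p) := by
  convert! hasMean_tsum hc (-fun i => (p i : ℤ)) using 1
  · ext t; rw [mFourier_neg]; rfl
  · rw [tsum_eq_single p]
    · simp
    · intro q hq
      rw [if_neg, mul_zero]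
      refine fun h => hq (funext fun i => ?_)
      have := congrFun h i
      simp only [Pi.add_apply, Pi.neg_apply, Pi.zero_apply] at this
      omega

theorem hasMean_torusMonomial {k : ℕ} {p : Fin k → ℕ} (hp : p ≠ 0) :
    HasMean (torusMonomial p) 0 := by
  convert! hasMean_mFourier (fun i => (p i : ℤ)) using 1
  rw [if_neg]
  exact fun h => hp (funext fun i => by simpa using congrFun h i)

/-! ### A Wiener type estimate for operator-valued Fourier series on the torus -/

section Wiener

variable {k : ℕ} {E : Type*} [NormedAddCommGroup E] [InnerProductSpace ℂ E]
  {T : (Fin k → ℕ) → (E →L[ℂ] E)} {M : ℝ} {a₀ : ℂ}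

/-- Contractivity of the block `[[T₀, 0], [T_p, T₀]]` of the Toeplitz operator with symbol
`∑ z^q T_q`, in weak form: the symbol is tested against `u₀ + z^p u₁` and `v₀ + z^p v₁`, and the
inequality `2 Re ⟪η, S ξ⟫ ≤ M² ‖ξ‖² + ‖η‖²` is averaged over the torus. -/
theorem two_mul_re_inner_toeplitz_le
    (hT : ∀ t, ∃ S, HasSum (fun q => torusMonomial q t • T q) S ∧ ‖S‖ ≤ M)
    {p : Fin k → ℕ} (hp : p ≠ 0) (u₀ u₁ v₀ v₁ : E) :
    2 * (inner ℂ v₀ (T 0 u₀) + inner ℂ v₁ (T p u₀ + T 0 u₁)).re ≤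
      M ^ 2 * (‖u₀‖ ^ 2 + ‖u₁‖ ^ 2) + (‖v₀‖ ^ 2 + ‖v₁‖ ^ 2) := by
  choose S hS hSM using hT
  have hsum (v u : E) (t) :
      HasSum (fun q => torusMonomial q t * inner ℂ v (T q u)) (inner ℂ v (S t u)) := by
    have h := ((hS t).mapL (ContinuousLinearMap.apply ℂ E u)).mapL (innerSL ℂ v)
    simpa [inner_smul_right] using h
  -- Scalar series are absolutely convergent; at `t = 0` all the characters are `1`.
  have habs (v u : E) : Summable fun q => ‖inner ℂ v (T q u)‖ := by
    refine (hsum v u 0).summable.norm.congr fun q => ?_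
    simp [torusMonomial, norm_mFourier_apply]
  have htsum (v u : E) (t) := (hsum v u t).tsum_eq
  have m1 := hasMean_tsum_zero (habs v₀ u₀)
  have m2 := hasMean_tsum_zero (habs v₁ u₁)
  have m3 := hasMean_tsum_mul (habs v₀ u₁) hp
  have m4 := hasMean_tsum_mul_conj (habs v₁ u₀) p
  have m5 := (hasMean_torusMonomial hp).const_mul (M ^ 2 * 2 * inner ℂ u₀ u₁)
  have m6 := (hasMean_torusMonomial hp).const_mul (2 * inner ℂ v₀ v₁)
  have m7 := hasMean_const (k := k)
    ((M ^ 2 * (‖u₀‖ ^ 2 + ‖u₁‖ ^ 2) + (‖v₀‖ ^ 2 + ‖v₁‖ ^ 2) : ℝ) : ℂ)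
  simp only [htsum] at m1 m2 m3 m4
  have h := ((m7.add (m5.add m6)).add (((m1.add m2).add (m3.add m4)).const_mul (-2))).re_nonneg ?_
  · simp only [mul_zero, zero_add, add_zero, Complex.add_re, Complex.ofReal_re, inner_add_right,
      Complex.mul_re, Complex.neg_re, Complex.re_ofNat, Complex.neg_im, Complex.im_ofNat,
      neg_zero, zero_mul, sub_zero] at h ⊢
    linarith
  · intro t
    set e := torusMonomial p t with he
    have hee : star e * e = 1 := by
      have : ‖e‖ = 1 := norm_mFourier_apply _ _
      rw [mul_comm]
      simpa [this] using Complex.mul_conj' e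
    have hen : ‖e‖ = 1 := norm_mFourier_apply _ _
    have hpar (a b : E) : ‖a + e • b‖ ^ 2 = ‖a‖ ^ 2 + ‖b‖ ^ 2 + 2 * (e * inner ℂ a b).re := by
      rw [norm_add_sq (𝕜 := ℂ), norm_smul, hen, inner_smul_right]
      simp only [RCLike.re_to_complex]; ring
    have hin : inner ℂ (v₀ + e • v₁) (S t (u₀ + e • u₁)) =
        inner ℂ v₀ (S t u₀) + inner ℂ v₁ (S t u₁) +
          (inner ℂ v₀ (S t u₁) * e + inner ℂ v₁ (S t u₀) * star e) := by
      simp only [map_add, map_smul, inner_add_left, inner_add_right, inner_smul_left,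
        inner_smul_right]
      simp only [Complex.star_def] at hee ⊢
      linear_combination (inner ℂ v₁ (S t u₁)) * hee
    have h1 : (inner ℂ (v₀ + e • v₁) (S t (u₀ + e • u₁))).re ≤
        ‖v₀ + e • v₁‖ * (M * ‖u₀ + e • u₁‖) :=
      (Complex.re_le_norm _).trans ((norm_inner_le_norm _ _).trans
        (mul_le_mul_of_nonneg_left ((S t).le_of_opNorm_le (hSM t) _) (norm_nonneg _)))
    have h2 := hpar u₀ u₁
    have h3 := hpar v₀ v₁
    have h4 := two_mul_le_add_sq (M * ‖u₀ + e • u₁‖) ‖v₀ + e • v₁‖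
    rw [mul_pow, h2, h3] at h4
    rw [hin] at h1
    have e1 : ((M : ℂ) ^ 2 * 2 * inner ℂ u₀ u₁ * e).re = M ^ 2 * 2 * (e * inner ℂ u₀ u₁).re := by
      rw [mul_assoc, mul_comm _ e]; norm_cast; exact Complex.re_ofReal_mul _ _
    have e2 : (2 * inner ℂ v₀ v₁ * e).re = 2 * (e * inner ℂ v₀ v₁).re := by
      rw [mul_assoc, mul_comm _ e]; exact Complex.re_ofReal_mul 2 _
    have e3 (w : ℂ) : (-2 * w).re = -2 * w.re := by
      simp
    rw [Complex.add_re, Complex.add_re, Complex.add_re, e1, e2, e3, Complex.ofReal_re]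
    linarith

/-- The Wiener inequality `‖T_p‖ ≤ M - |a₀|² / M`, in a form that is also meaningful for `M = 0`. -/
theorem mul_norm_coeff_le (hM : 0 ≤ M)
    (hT : ∀ t, ∃ S, HasSum (fun q => torusMonomial q t • T q) S ∧ ‖S‖ ≤ M)
    (h0 : T 0 = a₀ • 1) (ha : ‖a₀‖ ≤ M) {p : Fin k → ℕ} (hp : p ≠ 0) :
    M * ‖T p‖ ≤ M ^ 2 - ‖a₀‖ ^ 2 := by
  have hD : 0 ≤ M ^ 2 - ‖a₀‖ ^ 2 := by nlinarith [norm_nonneg a₀]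
  have key (x : E) (l : ℂ) : ‖a₀‖ ^ 2 * ‖x‖ ^ 2 + ‖1 + a₀ * l‖ ^ 2 * ‖T p x‖ ^ 2 ≤
      M ^ 2 * (‖x‖ ^ 2 + ‖l‖ ^ 2 * ‖T p x‖ ^ 2) := by
    -- `v` is the image of `u = (x, l T_p x)` under the Toeplitz block, so `2‖v‖² ≤ M²‖u‖² + ‖v‖²`.
    have h := two_mul_re_inner_toeplitz_le hT hp x (l • T p x) (a₀ • x) ((1 + a₀ * l) • T p x)
    have e1 : T 0 x = a₀ • x := by simp [h0]
    have e2 : T p x + T 0 (l • T p x) = (1 + a₀ * l) • T p x := by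
      simp [h0, add_smul, mul_smul, smul_comm l a₀]
    rw [e1, e2, Complex.add_re] at h
    have e3 (y : E) : (inner ℂ y y).re = ‖y‖ ^ 2 := (norm_sq_eq_re_inner (𝕜 := ℂ) y).symm
    rw [e3, e3] at h
    simp only [norm_smul, mul_pow] at h
    linarith
  have hx (x : E) : M * ‖T p x‖ ≤ (M ^ 2 - ‖a₀‖ ^ 2) * ‖x‖ := by
    rcases hM.eq_or_lt with rfl | hMpos
    · simpa using mul_nonneg hD (norm_nonneg x)
    have hreal (s : ℝ) : ‖1 + a₀ * (s * star a₀)‖ ^ 2 = (1 + s * ‖a₀‖ ^ 2) ^ 2 ∧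
        ‖(s : ℂ) * star a₀‖ ^ 2 = s ^ 2 * ‖a₀‖ ^ 2 := by
      constructor
      · have : 1 + a₀ * (s * star a₀) = ((1 + s * ‖a₀‖ ^ 2 : ℝ) : ℂ) := by
          have := Complex.mul_conj' a₀
          push_cast
          rw [← this]
          simp only [Complex.star_def]
          ring
        rw [this, Complex.norm_real, Real.norm_eq_abs, sq_abs]
      · simp [mul_pow]
    rcases hD.eq_or_lt with hD0 | hDpos
    · -- In the extremal case `|a₀| = M`, the multiplier `conj a₀` forces `T_p x = 0`.
      have h := key x ((1 : ℝ) * star a₀)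
      rw [(hreal 1).1, (hreal 1).2] at h
      rw [← hD0, zero_mul]
      have ha2 : ‖a₀‖ ^ 2 = M ^ 2 := by linarith
      rw [ha2] at h
      have : ‖T p x‖ ^ 2 ≤ 0 := by nlinarith [sq_nonneg (M * ‖T p x‖), sq_nonneg ‖T p x‖]
      have : ‖T p x‖ = 0 := by simpa using le_antisymm this (sq_nonneg _)
      simp [this]
    · -- The optimal multiplier is `conj a₀ / (M² - |a₀|²)`.
      set D := M ^ 2 - ‖a₀‖ ^ 2 with hDdef
      have h := key x ((D⁻¹ : ℝ) * star a₀)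
      rw [(hreal _).1, (hreal _).2] at h
      have ha2 : ‖a₀‖ ^ 2 = M ^ 2 - D := by rw [hDdef]; ring
      rw [ha2] at h
      have e1 : 1 + D⁻¹ * (M ^ 2 - D) = M ^ 2 * D⁻¹ := by field_simp; ring
      rw [e1] at h
      have h2 : M ^ 2 * D⁻¹ * ‖T p x‖ ^ 2 ≤ D * ‖x‖ ^ 2 := by
        have e2 : (M ^ 2 * D⁻¹) ^ 2 * ‖T p x‖ ^ 2 - M ^ 2 * (D⁻¹ ^ 2 * (M ^ 2 - D) * ‖T p x‖ ^ 2)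
            = M ^ 2 * D⁻¹ * ‖T p x‖ ^ 2 := by field_simp; ring
        linarith
      refine le_of_sq_le_sq ?_ (by positivity)
      have h3 := mul_le_mul_of_nonneg_left h2 hDpos.le
      have e3 : D * (M ^ 2 * D⁻¹ * ‖T p x‖ ^ 2) = (M * ‖T p x‖) ^ 2 := by field_simp
      nlinarith
  rcases hM.eq_or_lt with rfl | hMpos
  · simpa using hD
  have := (T p).opNorm_le_bound (M := (M ^ 2 - ‖a₀‖ ^ 2) / M) (by positivity) fun x => by
    rw [div_mul_eq_mul_div, le_div_iff₀ hMpos, mul_comm]; exact hx x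
  rwa [le_div_iff₀ hMpos, mul_comm] at this

end Wiener

/-! ### Multiple geometric series -/

theorem hasSum_prod_geometric {k : ℕ} {r : Fin k → ℝ} (hr : ∀ i, 0 ≤ r i ∧ r i < 1) :
    HasSum (fun p : Fin k → ℕ => ∏ i, r i ^ p i) (∏ i, (1 - r i)⁻¹) := by
  induction k with
  | zero => simp
  | succ k ih =>
    have h1 := hasSum_geometric_of_lt_one (hr 0).1 (hr 0).2
    have h2 := ih fun i : Fin k => hr i.succ
    have p1 : ∀ m : ℕ, (0 : ℝ) ≤ r 0 ^ m := fun m => pow_nonneg (hr 0).1 m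
    have p2 : ∀ p : Fin k → ℕ, (0 : ℝ) ≤ ∏ i, r i.succ ^ p i :=
      fun p => Finset.prod_nonneg fun i _ => pow_nonneg (hr i.succ).1 _
    have hs := h1.summable.mul_of_nonneg h2.summable p1 p2
    have h3 := h1.mul h2 hs
    rw [Fin.prod_univ_succ, ← (Fin.consEquiv fun _ : Fin (k + 1) => ℕ).hasSum_iff]
    refine h3.congr_fun ?_
    rintro ⟨m, p⟩
    simp [Fin.prod_univ_succ, Fin.consEquiv]

/-- Termwise domination by the multiple geometric series, with a separate bound for the constant
term. -/
theorem summable_and_tsum_le_of_geometric {k : ℕ} {r : Fin k → ℝ}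
    (hr : ∀ i, 0 ≤ r i ∧ r i < 1) {c : (Fin k → ℕ) → ℝ} {A D : ℝ} (hc : ∀ p, 0 ≤ c p)
    (h0 : c 0 ≤ A) (h : ∀ p, p ≠ 0 → c p ≤ (∏ i, r i ^ p i) * D) :
    Summable c ∧ ∑' p, c p ≤ A + D * ((∏ i, (1 - r i)⁻¹) - 1) := by
  have hg := (hasSum_prod_geometric hr).mul_right D
  have h1 := hg.add (hasSum_ite_eq (0 : Fin k → ℕ) (A - D))
  have hle : ∀ p, c p ≤ (∏ i, r i ^ p i) * D + if p = 0 then A - D else 0 := by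
    intro p
    rcases eq_or_ne p 0 with rfl | hp
    · simpa using h0
    · simpa [hp] using h p hp
  have hs := Summable.of_nonneg_of_le hc hle h1.summable
  refine ⟨hs, (hasSum_le hle hs.hasSum h1).trans_eq ?_⟩
  ring

/-! ### Operators on an abstract inner product space -/

-- These facts are applied with `E = K ⊗ H`. Instance search finds on that completion a module
-- structure which agrees with the one underlying the norm only after unfolding, so the general
-- lemmas about normed spaces do not apply there directly.

section Operators

variable {E : Type*} [NormedAddCommGroup E] [InnerProductSpace ℂ E]

theorem norm_smul_operator (c : ℂ) (T : E →L[ℂ] E) : ‖c • T‖ = ‖c‖ * ‖T‖ := norm_smul c T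

theorem norm_operator_nonneg (T : E →L[ℂ] E) : 0 ≤ ‖T‖ := norm_nonneg T

theorem norm_smul_one_operator [Nontrivial E] (c : ℂ) : ‖c • (1 : E →L[ℂ] E)‖ = ‖c‖ := by
  rw [norm_smul, norm_one, mul_one]

theorem norm_smul_one_operator_le (c : ℂ) : ‖c • (1 : E →L[ℂ] E)‖ ≤ ‖c‖ := by
  rw [norm_smul]
  exact mul_le_of_le_one_right (norm_nonneg c) ContinuousLinearMap.norm_id_le

theorem continuous_of_linear_of_norm_le {G : Type*} [SeminormedAddCommGroup G] [NormedSpace ℂ G]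
    {f : G → (E →L[ℂ] E)} (hadd : ∀ x y, f (x + y) = f x + f y)
    (hsmul : ∀ (c : ℂ) x, f (c • x) = c • f x) {C : ℝ} (hC : ∀ x, ‖f x‖ ≤ C * ‖x‖) :
    Continuous f :=
  (LinearMap.mkContinuous
    ({ toFun := f, map_add' := hadd, map_smul' := hsmul } : G →ₗ[ℂ] (E →L[ℂ] E)) C hC).continuous

theorem isClosed_setOf_norm_operator_le {G : Type*} [TopologicalSpace G] {f : G → (E →L[ℂ] E)}
    (hf : Continuous f) (C : ℝ) : IsClosed {x | ‖f x‖ ≤ C} :=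
  isClosed_le hf.norm continuous_const

end Operators

/-! ### Words evaluated at rescaled tuples -/

section Words

variable {k : ℕ} {n : Fin k → ℕ} {H : Type v} [NormedAddCommGroup H] [InnerProductSpace ℂ H]

/-- The tuple `(w_i X_{i,j})`, for complex weights `w`. -/
def twist (w : Fin k → ℂ) (X : OpTuple n H) : OpTuple n H :=
  fun i j => w i • X i j

theorem scale_eq_twist (r : Fin k → ℝ) (X : OpTuple n H) :
    scale r X = twist (fun i => (r i : ℂ)) X := rfl

theorem lift_smul {m : ℕ} (c : ℂ) (T : Fin m → (H →L[ℂ] H)) (α : FreeMonoid (Fin m)) :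
    FreeMonoid.lift (fun j => c • T j) α = c ^ α.length • FreeMonoid.lift T α := by
  induction α using FreeMonoid.inductionOn' with
  | one => simp
  | of_mul x xs ih =>
    simp only [map_mul, FreeMonoid.lift_eval_of, ih, FreeMonoid.length_mul,
      FreeMonoid.length_of, smul_mul_smul_comm, pow_add, pow_one]

theorem prod_ofFn_smul {A : Type*} [Ring A] [Algebra ℂ A] : ∀ {m : ℕ} (c : Fin m → ℂ)
    (f : Fin m → A), (List.ofFn fun i => c i • f i).prod = (∏ i, c i) • (List.ofFn f).prod
  | 0, c, f => by simp
  | m + 1, c, f => by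
    simp only [List.ofFn_succ, List.prod_cons, Fin.prod_univ_succ,
      prod_ofFn_smul (fun i => c (Fin.succ i)), smul_mul_smul_comm]

theorem wordEval_twist (w : Fin k → ℂ) (X : OpTuple n H) (α : MultiWord n) :
    wordEval (twist w X) α = (∏ i, w i ^ (α i).length) • wordEval X α := by
  have h (i : Fin k) : FreeMonoid.lift (twist w X i) (α i) =
      w i ^ (α i).length • FreeMonoid.lift (X i) (α i) := lift_smul _ _ _
  simp only [wordEval, h, prod_ofFn_smul]

theorem mem_multiWordsFinset {p : Fin k → ℕ} {α : MultiWord n} :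
    α ∈ multiWordsFinset n p ↔ ∀ i, (α i).length = p i := by
  simp [multiWordsFinset, multiWordsOfDegree]

theorem wordEval_twist_of_mem (w : Fin k → ℂ) (X : OpTuple n H) {p : Fin k → ℕ}
    {α : MultiWord n} (hα : α ∈ multiWordsFinset n p) :
    wordEval (twist w X) α = (∏ i, w i ^ p i) • wordEval X α := by
  rw [wordEval_twist]
  simp only [mem_multiWordsFinset.1 hα]

theorem multiWordsFinset_zero : multiWordsFinset n 0 = {1} := by
  ext α
  simp [mem_multiWordsFinset, FreeMonoid.length_eq_zero, funext_iff]

theorem wordEval_one (X : OpTuple n H) : wordEval X 1 = 1 := by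
  simp [wordEval]

theorem continuous_wordEval (α : MultiWord n) :
    Continuous fun X : OpTuple n H => wordEval X α := by
  have h (i : Fin k) (β : FreeMonoid (Fin (n i))) :
      Continuous fun X : OpTuple n H => FreeMonoid.lift (X i) β := by
    induction β using FreeMonoid.inductionOn' with
    | one => simpa using continuous_const
    | of_mul x xs ih =>
      simp only [map_mul, FreeMonoid.lift_eval_of]
      have h1 : Continuous fun X : OpTuple n H => X i x :=
        (continuous_apply x).comp (continuous_apply i)
      exact h1.mul ih
  simp only [wordEval, List.ofFn_eq_map]
  exact continuous_list_prod _ fun i _ => h i (α i)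

theorem prod_zero_pow {p : Fin k → ℕ} (hp : p ≠ 0) : ∏ i, (0 : ℂ) ^ p i = 0 := by
  obtain ⟨i, hi⟩ := Function.ne_iff.mp hp
  exact Finset.prod_eq_zero (Finset.mem_univ i) (zero_pow hi)

theorem zero_eq_twist : (0 : OpTuple n H) = twist 0 0 := by
  ext; simp [twist]

/-! ### Multi-homogeneous parts -/

variable (a : MultiWord n → ℂ)

theorem scalarHomPart_twist (w : Fin k → ℂ) (X : OpTuple n H) (p : Fin k → ℕ) :
    scalarHomPart a (twist w X) p = (∏ i, w i ^ p i) • scalarHomPart a X p := by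
  rw [scalarHomPart, scalarHomPart, Finset.smul_sum]
  exact Finset.sum_congr rfl fun α hα => by rw [wordEval_twist_of_mem w X hα, smul_comm]

theorem scalarHomPart_zero_degree (X : OpTuple n H) : scalarHomPart a X 0 = a 1 • 1 := by
  simp [scalarHomPart, multiWordsFinset_zero, wordEval_one]

theorem scalarValue_zero : scalarValue a (0 : OpTuple n H) = a 1 • 1 := by
  rw [scalarValue, tsum_eq_single 0, scalarHomPart_zero_degree]
  intro p hp
  rw [zero_eq_twist, scalarHomPart_twist]
  simp only [Pi.zero_apply, prod_zero_pow hp, zero_smul]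

theorem continuous_scalarHomPart (p : Fin k → ℕ) :
    Continuous fun X : OpTuple n H => scalarHomPart a X p :=
  continuous_finsetSum _ fun α _ => (continuous_wordEval α).fun_const_smul _

variable {K : Type u} [NormedAddCommGroup K] [InnerProductSpace ℂ K]

theorem opTensor_coe (A : K →L[ℂ] K) (X : H →L[ℂ] H) (x : K ⊗[ℂ] H) :
    opTensor A X (x : HilbertTensor K H) = (TensorProduct.mapL A X x : K ⊗[ℂ] H) :=
  ContinuousLinearMap.completion_apply_coe _ _

theorem hilbertTensor_hom_ext {f g : HilbertTensor K H →L[ℂ] HilbertTensor K H}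
    (h : ∀ x : K ⊗[ℂ] H, f (x : HilbertTensor K H) = g (x : HilbertTensor K H)) : f = g :=
  ContinuousLinearMap.ext fun x => Completion.induction_on x
    (isClosed_eq f.continuous g.continuous) h

theorem opTensor_smul (A : K →L[ℂ] K) (c : ℂ) (X : H →L[ℂ] H) :
    opTensor A (c • X) = c • opTensor A X := by
  refine hilbertTensor_hom_ext fun x => ?_
  rw [smul_apply, opTensor_coe, opTensor_coe, TensorProduct.mapL_smul_right,
    ← Completion.coe_smul]
  rfl

theorem opTensor_add (A : K →L[ℂ] K) (X Y : H →L[ℂ] H) :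
    opTensor A (X + Y) = opTensor A X + opTensor A Y := by
  refine hilbertTensor_hom_ext fun x => ?_
  rw [add_apply, opTensor_coe, opTensor_coe, opTensor_coe,
    TensorProduct.mapL_add_right, ← Completion.coe_add]
  rfl

theorem norm_opTensor_le (A : K →L[ℂ] K) (X : H →L[ℂ] H) :
    ‖opTensor A X‖ ≤ ‖A‖ * ‖X‖ := by
  refine ContinuousLinearMap.opNorm_le_bound _ (by positivity) fun x => ?_
  induction x using Completion.induction_on with
  | hp => exact isClosed_le (by fun_prop) (by fun_prop)
  | ih x =>
    rw [opTensor_coe, Completion.norm_coe, Completion.norm_coe]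
    exact ContinuousLinearMap.le_of_opNorm_le _ (TensorProduct.norm_mapL_le A X) x

theorem continuous_opTensor (A : K →L[ℂ] K) :
    Continuous fun X : H →L[ℂ] H => opTensor A X :=
  continuous_of_linear_of_norm_le (opTensor_add A) (opTensor_smul A) (norm_opTensor_le A)

variable (A : MultiWord n → (K →L[ℂ] K))

theorem homPart_twist (w : Fin k → ℂ) (X : OpTuple n H) (p : Fin k → ℕ) :
    homPart A (twist w X) p = (∏ i, w i ^ p i) • homPart A X p := by
  rw [homPart, homPart, Finset.smul_sum]
  exact Finset.sum_congr rfl fun α hα => by rw [wordEval_twist_of_mem w X hα, opTensor_smul]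

theorem value_zero (X : OpTuple n H) : value A (0 : OpTuple n H) = homPart A X 0 := by
  rw [value, tsum_eq_single 0]
  · simp [homPart, multiWordsFinset_zero, wordEval_one]
  · intro p hp
    rw [zero_eq_twist, homPart_twist]
    simp only [Pi.zero_apply, prod_zero_pow hp, zero_smul]

theorem continuous_homPart (p : Fin k → ℕ) :
    Continuous fun X : OpTuple n H => homPart A X p :=
  continuous_finsetSum _ fun α _ => (continuous_opTensor (A α)).comp (continuous_wordEval α)

end Words

/-! ### The regular polyball -/

/-- If the factors of a product preserve the positive multiples of the identity, so does the
product; this evaluates the defect map at tuples of scalar operators. -/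
theorem prod_apply_one_eq_smul_one {H : Type v} [NormedAddCommGroup H]
    [InnerProductSpace ℂ H] (l : List (Module.End ℂ (H →L[ℂ] H)))
    (hl : ∀ f ∈ l, ∀ y : ℝ, 0 < y → ∃ y' : ℝ, 0 < y' ∧
      f ((y : ℂ) • (1 : H →L[ℂ] H)) = (y' : ℂ) • (1 : H →L[ℂ] H)) :
    ∃ y : ℝ, 0 < y ∧ l.prod (1 : H →L[ℂ] H) = (y : ℂ) • (1 : H →L[ℂ] H) := by
  induction l with
  | nil => exact ⟨1, one_pos, by simp⟩
  | cons f l ih =>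
    obtain ⟨y, hy, h⟩ := ih fun g hg => hl g (List.mem_cons_of_mem _ hg)
    obtain ⟨y', hy', h'⟩ := hl f List.mem_cons_self y hy
    exact ⟨y', hy', by rw [List.prod_cons, Module.End.mul_apply, h, h']⟩

section Polyball

variable {k : ℕ} {n : Fin k → ℕ} {H : Type v} [NormedAddCommGroup H] [InnerProductSpace ℂ H]
  [CompleteSpace H]

theorem smul_mul_adjoint_smul (c : ℂ) (T Y : H →L[ℂ] H) :
    (c • T) * Y * ContinuousLinearMap.adjoint (c • T) =
      (((‖c‖ ^ 2 : ℝ)) : ℂ) • (T * Y * ContinuousLinearMap.adjoint T) := by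
  have : ContinuousLinearMap.adjoint (c • T) = star c • ContinuousLinearMap.adjoint T :=
    star_smul c T
  rw [this, smul_mul_assoc, smul_mul_smul_comm]
  congr 1
  simpa using Complex.mul_conj' c

/-- Rotating each row of a tuple by a unimodular scalar changes neither the maps `Φ_{X_i}` nor the
commutation relations, so it preserves the regular polyball. -/
theorem twist_mem_regularPolyball {w : Fin k → ℂ} (hw : ∀ i, ‖w i‖ = 1) {X : OpTuple n H}
    (hX : X ∈ regularPolyball n H) : twist w X ∈ regularPolyball n H := by
  have hrow (i : Fin k) (Y : H →L[ℂ] H) : rowMap (twist w X i) Y = rowMap (X i) Y := by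
    simp only [rowMap_apply, twist, smul_mul_adjoint_smul, hw, one_pow, Complex.ofReal_one,
      one_smul]
  have hdef : defectMap (twist w X) = defectMap X := by
    simp only [defectMap, fun i => LinearMap.ext (hrow i)]
  obtain ⟨h1, h2, h3, h4⟩ := hX
  refine ⟨fun s t hst a b => ((h1 s t hst a b).smul_left _).smul_right _, fun i => ?_,
    hdef ▸ h3, hdef ▸ h4⟩
  have := hrow i 1
  simp only [rowMap_apply, mul_one] at this
  rw [this]
  exact h2 i

variable (H) in
/-- The tuple of scalar operators `x_{i,j} I`. -/
def scalarTuple (x : ∀ i, Fin (n i) → ℂ) : OpTuple n H :=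
  fun i j => x i j • 1

theorem rowMap_scalarTuple (x : ∀ i, Fin (n i) → ℂ) (i : Fin k) (y : ℝ) :
    rowMap (scalarTuple H x i) ((y : ℂ) • 1) = (((∑ j, ‖x i j‖ ^ 2) * y : ℝ) : ℂ) • 1 := by
  simp only [rowMap_apply, scalarTuple, smul_mul_adjoint_smul]
  have : ContinuousLinearMap.adjoint (1 : H →L[ℂ] H) = 1 := star_one _
  simp only [this, one_mul, mul_one, smul_smul, ← Finset.sum_smul]
  push_cast
  rw [Finset.sum_mul]

/-- The part of the regular polyball consisting of scalar operators is a product of Euclidean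
balls. -/
theorem scalarTuple_mem_regularPolyball {x : ∀ i, Fin (n i) → ℂ}
    (hx : ∀ i, ∑ j, ‖x i j‖ ^ 2 < 1) : scalarTuple H x ∈ regularPolyball n H := by
  obtain ⟨y, hy, h⟩ := prod_apply_one_eq_smul_one
    (List.ofFn fun i : Fin k => 1 - rowMap (scalarTuple H x i)) (by
      intro f hf y hy
      obtain ⟨i, rfl⟩ := List.mem_ofFn.1 hf
      refine ⟨(1 - ∑ j, ‖x i j‖ ^ 2) * y, mul_pos (sub_pos.2 (hx i)) hy, ?_⟩
      rw [LinearMap.sub_apply, rowMap_scalarTuple, Module.End.one_apply, ← sub_smul]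
      push_cast; ring_nf)
  refine ⟨fun s t _ a b => ?_, fun i => ?_, ?_, ?_⟩
  · exact ((Commute.one_left _).smul_left _).smul_right _
  · have h1 := rowMap_scalarTuple (H := H) x i 1
    simp only [rowMap_apply, Complex.ofReal_one, one_smul, mul_one] at h1
    rw [h1]
    have h0 : 0 ≤ ∑ j, ‖x i j‖ ^ 2 := Finset.sum_nonneg fun _ _ => sq_nonneg _
    rw [Real.sqrt_lt' one_pos, one_pow]
    refine lt_of_le_of_lt ?_ (hx i)
    rw [norm_smul, Complex.norm_real, Real.norm_of_nonneg h0]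
    exact mul_le_of_le_one_right h0 ContinuousLinearMap.norm_id_le
  · rw [defectMap, h]
    have hy' : (0 : ℂ) ≤ y := by exact_mod_cast hy.le
    exact ContinuousLinearMap.isPositive_one.smul_of_nonneg hy'
  · rw [defectMap, h]
    exact isUnit_one.smul (Units.mk0 (y : ℂ) (by exact_mod_cast hy.ne'))

theorem zero_mem_regularPolyball : (0 : OpTuple n H) ∈ regularPolyball n H := by
  have h := scalarTuple_mem_regularPolyball (n := n) (H := H) (x := fun _ _ => 0) (by simp)
  convert! h using 1
  ext; simp [scalarTuple]

/-- The point of the torus with coordinates `exp (2π i t_i)`. -/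
noncomputable def torusPoint (t : UnitAddTorus (Fin k)) (i : Fin k) : ℂ :=
  fourier 1 (t i)

theorem norm_torusPoint (t : UnitAddTorus (Fin k)) (i : Fin k) : ‖torusPoint t i‖ = 1 := by
  rw [torusPoint, fourier_apply]
  exact Circle.norm_coe _

theorem prod_torusPoint_pow (t : UnitAddTorus (Fin k)) (p : Fin k → ℕ) :
    ∏ i, torusPoint t i ^ p i = torusMonomial p t := by
  simp only [torusPoint, torusMonomial, mFourier, ContinuousMap.coe_mk]
  refine Finset.prod_congr rfl fun i _ => ?_
  simp only [fourier_apply, one_smul, AddCircle.toCircle_zsmul]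
  simp

/-! ### Wiener inequalities on the closed polyball -/

theorem norm_scalarValue_le {a : MultiWord n → ℂ} (ha : a ∈ hardySpace.{v} n)
    {X : OpTuple n H} (hX : X ∈ regularPolyball n H) :
    ‖scalarValue a X‖ ≤ scalarSupNorm.{v} a :=
  le_csSup ha.2 ⟨H, _, _, _, X, hX, rfl⟩

/-- The supremum ranges over all spaces, so evaluating at `X = 0` on a one-dimensional one
suffices. -/
theorem norm_coeff_one_le {a : MultiWord n → ℂ} (ha : a ∈ hardySpace.{v} n) :
    ‖a 1‖ ≤ scalarSupNorm.{v} a := by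
  have h := norm_scalarValue_le ha
    (zero_mem_regularPolyball (n := n) (H := EuclideanSpace ℂ PUnit.{v + 1}))
  rwa [scalarValue_zero, norm_smul, norm_one, mul_one] at h

/-- On the open polyball, this is the Wiener inequality for the series of the rotated tuples
`(z_i X_{i,j})`; both sides are continuous in `X`, which gives the closure. -/
theorem mul_norm_scalarHomPart_le {a : MultiWord n → ℂ} (ha : a ∈ hardySpace.{v} n)
    {M : ℝ} (hM : scalarSupNorm.{v} a ≤ M)
    {X : OpTuple n H} (hX : X ∈ closure (regularPolyball n H)) {p : Fin k → ℕ} (hp : p ≠ 0) :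
    M * ‖scalarHomPart a X p‖ ≤ M ^ 2 - ‖a 1‖ ^ 2 := by
  refine closure_minimal (s := regularPolyball n H) (t := {X | M * ‖scalarHomPart a X p‖ ≤ _})
    (fun X hX => ?_)
    (isClosed_le (continuous_const.mul (continuous_scalarHomPart a p).norm) continuous_const) hX
  have h1 := (norm_coeff_one_le ha).trans hM
  refine mul_norm_coeff_le ((norm_nonneg _).trans h1) (fun t => ?_)
    (scalarHomPart_zero_degree a X) h1 hp
  have hmem := twist_mem_regularPolyball (norm_torusPoint t) hX
  refine ⟨scalarValue a (twist (torusPoint t) X), ?_, (norm_scalarValue_le ha hmem).trans hM⟩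
  refine (ha.1 H _ hmem).hasSum.congr_fun fun p => ?_
  rw [scalarHomPart_twist, prod_torusPoint_pow]

variable {K : Type u} [NormedAddCommGroup K] [InnerProductSpace ℂ K]

theorem norm_value_le {A : MultiWord n → (K →L[ℂ] K)} (hA : IsBoundedFreeHolomorphic.{u, v} A)
    {X : OpTuple n H} (hX : X ∈ regularPolyball n H) : ‖value A X‖ ≤ supNorm.{u, v} A :=
  le_csSup hA.2 ⟨H, _, _, _, X, hX, rfl⟩

instance [Nontrivial K] [Nontrivial H] : Nontrivial (HilbertTensor K H) := by
  obtain ⟨x, hx⟩ := exists_ne (0 : K)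
  obtain ⟨y, hy⟩ := exists_ne (0 : H)
  refine nontrivial_of_ne ((x ⊗ₜ[ℂ] y : K ⊗[ℂ] H) : HilbertTensor K H) 0 ?_
  rw [← norm_ne_zero_iff, Completion.norm_coe, TensorProduct.norm_tmul]
  exact mul_ne_zero (norm_ne_zero_iff.2 hx) (norm_ne_zero_iff.2 hy)

theorem norm_value_zero_le [Nontrivial K] {A : MultiWord n → (K →L[ℂ] K)}
    (hA : IsBoundedFreeHolomorphic.{u, v} A) {a₀ : ℂ}
    (h0 : ∀ (H : Type v) [NormedAddCommGroup H] [InnerProductSpace ℂ H] [CompleteSpace H],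
      value A (0 : OpTuple n H) = a₀ • 1) : ‖a₀‖ ≤ supNorm.{u, v} A := by
  have h := norm_value_le hA
    (zero_mem_regularPolyball (n := n) (H := EuclideanSpace ℂ PUnit.{v + 1}))
  rwa [h0, norm_smul_one_operator] at h

/-- The operator-coefficient counterpart of `mul_norm_scalarHomPart_le`. The bound `‖a₀‖ ≤ 1` is a
hypothesis because the given `H` may be trivial. -/
theorem norm_homPart_le {A : MultiWord n → (K →L[ℂ] K)} (hA : IsBoundedFreeHolomorphic.{u, v} A)
    (hA1 : supNorm.{u, v} A ≤ 1) {a₀ : ℂ} (ha₀ : ‖a₀‖ ≤ 1)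
    (h0 : value A (0 : OpTuple n H) = a₀ • 1)
    {X : OpTuple n H} (hX : X ∈ closure (regularPolyball n H)) {p : Fin k → ℕ} (hp : p ≠ 0) :
    ‖homPart A X p‖ ≤ 1 - ‖a₀‖ ^ 2 := by
  refine closure_minimal (s := regularPolyball n H) (t := {X | ‖homPart A X p‖ ≤ _})
    (fun X hX => ?_) (isClosed_setOf_norm_operator_le (continuous_homPart A p) _) hX
  have h := mul_norm_coeff_le zero_le_one (T := homPart A X) (fun t => ?_)
    (by rw [← value_zero, h0]) ha₀ hp
  · simpa using h
  have hmem := twist_mem_regularPolyball (norm_torusPoint t) hX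
  refine ⟨value A (twist (torusPoint t) X), ?_, (norm_value_le hA hmem).trans hA1⟩
  refine (hA.1 H _ hmem).hasSum.congr_fun fun p => ?_
  rw [homPart_twist, prod_torusPoint_pow]

end Polyball

/-! ### Bohr inequalities -/

section Bohr

variable {k : ℕ} {n : Fin k → ℕ} {H : Type v} [NormedAddCommGroup H] [InnerProductSpace ℂ H]

theorem norm_prod_ofReal_pow {r : Fin k → ℝ} (hr : ∀ i, 0 ≤ r i) (p : Fin k → ℕ) :
    ‖∏ i, (r i : ℂ) ^ p i‖ = ∏ i, r i ^ p i := by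
  rw [norm_prod]
  exact Finset.prod_congr rfl fun i _ => by
    rw [norm_pow, Complex.norm_real, Real.norm_of_nonneg (hr i)]

theorem norm_scalarHomPart_scale (a : MultiWord n → ℂ) {r : Fin k → ℝ} (hr : ∀ i, 0 ≤ r i)
    (Y : OpTuple n H) (p : Fin k → ℕ) :
    ‖scalarHomPart a (scale r Y) p‖ = (∏ i, r i ^ p i) * ‖scalarHomPart a Y p‖ := by
  rw [scale_eq_twist, scalarHomPart_twist, norm_smul, norm_prod_ofReal_pow hr]

variable {K : Type u} [NormedAddCommGroup K] [InnerProductSpace ℂ K]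

theorem norm_homPart_scale (A : MultiWord n → (K →L[ℂ] K)) {r : Fin k → ℝ} (hr : ∀ i, 0 ≤ r i)
    (Y : OpTuple n H) (p : Fin k → ℕ) :
    ‖homPart A (scale r Y) p‖ = (∏ i, r i ^ p i) * ‖homPart A Y p‖ := by
  rw [scale_eq_twist, homPart_twist, norm_smul_operator, norm_prod_ofReal_pow hr]

variable [CompleteSpace H]

theorem summable_norm_homPart_and_tsum_le [Nontrivial K] {A : MultiWord n → (K →L[ℂ] K)}
    (hA : IsBoundedFreeHolomorphic.{u, v} A) (hA1 : supNorm.{u, v} A ≤ 1) {a₀ : ℂ}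
    (h0 : ∀ (H : Type v) [NormedAddCommGroup H] [InnerProductSpace ℂ H] [CompleteSpace H],
      value A (0 : OpTuple n H) = a₀ • 1)
    {r : Fin k → ℝ} (hr : ∀ i, 0 ≤ r i ∧ r i < 1) {X : OpTuple n H}
    (hX : X ∈ scaledClosedPolyball n H r) :
    Summable (fun p => ‖homPart A X p‖) ∧
      ∑' p, ‖homPart A X p‖ ≤ ‖a₀‖ + (1 - ‖a₀‖ ^ 2) * ((∏ i, (1 - r i)⁻¹) - 1) := by
  obtain ⟨Y, hY, rfl⟩ := hX
  have ha₀ := (norm_value_zero_le hA h0).trans hA1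
  refine summable_and_tsum_le_of_geometric hr (fun p => norm_operator_nonneg _) ?_ fun p hp => ?_
  · rw [← value_zero, h0]
    exact norm_smul_one_operator_le a₀
  · rw [norm_homPart_scale A fun i => (hr i).1]
    exact mul_le_mul_of_nonneg_left (norm_homPart_le hA hA1 ha₀ (h0 H) hY hp)
      (Finset.prod_nonneg fun i _ => pow_nonneg (hr i).1 _)

theorem prod_inv_sub_one_le {r : Fin k → ℝ} (h : 2 / 3 ≤ ∏ i, (1 - r i)) :
    (∏ i, (1 - r i)⁻¹) - 1 ≤ 1 / 2 := by
  rw [Finset.prod_inv_distrib]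
  have : (∏ i, (1 - r i))⁻¹ ≤ (2 / 3)⁻¹ := inv_anti₀ (by norm_num) h
  norm_num at this ⊢
  linarith

/-- The scalar Bohr inequality. The estimate is proved with every `M > ‖φ‖_∞` in place of `‖φ‖_∞`,
which keeps the divisor `M` positive when `φ = 0`. -/
theorem summable_norm_scalarHomPart_and_tsum_le {a : MultiWord n → ℂ}
    (ha : a ∈ hardySpace.{v} n) {r : Fin k → ℝ} (hr : ∀ i, 0 ≤ r i ∧ r i < 1)
    (hr' : 2 / 3 ≤ ∏ i, (1 - r i)) {X : OpTuple n H} (hX : X ∈ scaledClosedPolyball n H r) :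
    Summable (fun p => ‖scalarHomPart a X p‖) ∧
      ∑' p, ‖scalarHomPart a X p‖ ≤ scalarSupNorm.{v} a := by
  obtain ⟨Y, hY, rfl⟩ := hX
  have ha1 := norm_coeff_one_le ha
  have hprod := prod_inv_sub_one_le hr'
  have key (M : ℝ) (hM : scalarSupNorm.{v} a < M) :
      Summable (fun p => ‖scalarHomPart a (scale r Y) p‖) ∧
        ∑' p, ‖scalarHomPart a (scale r Y) p‖ ≤ M := by
    have hM0 : 0 < M := (norm_nonneg _).trans_lt (ha1.trans_lt hM)
    have hD : 0 ≤ (M ^ 2 - ‖a 1‖ ^ 2) / M := by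
      refine div_nonneg ?_ hM0.le
      nlinarith [norm_nonneg (a 1)]
    obtain ⟨hs, hle⟩ := summable_and_tsum_le_of_geometric hr
      (c := fun p => ‖scalarHomPart a (scale r Y) p‖) (A := ‖a 1‖) (D := (M ^ 2 - ‖a 1‖ ^ 2) / M)
      (fun p => norm_nonneg _)
      (by rw [scalarHomPart_zero_degree]; exact norm_smul_one_operator_le _)
      (fun p hp => by
        rw [norm_scalarHomPart_scale a fun i => (hr i).1]
        refine mul_le_mul_of_nonneg_left ?_
          (Finset.prod_nonneg fun i _ => pow_nonneg (hr i).1 _)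
        rw [le_div_iff₀ hM0, mul_comm]
        exact mul_norm_scalarHomPart_le ha hM.le hY hp)
    refine ⟨hs, hle.trans ((add_le_add_right (mul_le_mul_of_nonneg_left hprod hD) _).trans ?_)⟩
    -- `|a| + (M² - |a|²) / (2M) ≤ M` is `(M - |a|)² ≥ 0`.
    have : ‖a 1‖ + (M ^ 2 - ‖a 1‖ ^ 2) / M * (1 / 2) = M - (M - ‖a 1‖) ^ 2 / (2 * M) := by
      field_simp; ring
    rw [this]
    exact sub_le_self _ (by positivity)
  exact ⟨(key _ (lt_add_one _)).1, le_of_forall_gt_imp_ge_of_dense fun M hM => (key M hM).2⟩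

theorem one_sub_rpow_mem_bohrSet (hk : 1 ≤ k) :
    1 - (2 / 3 : ℝ) ^ (1 / (k : ℝ)) ∈ bohrSet.{v} n := by
  have hk0 : (0 : ℝ) < k := by exact_mod_cast hk
  have h1 : (2 / 3 : ℝ) ^ (1 / (k : ℝ)) ≤ 1 :=
    Real.rpow_le_one (by norm_num) (by norm_num) (by positivity)
  have h2 : (0 : ℝ) < (2 / 3 : ℝ) ^ (1 / (k : ℝ)) := Real.rpow_pos_of_pos (by norm_num) _
  refine ⟨sub_nonneg.2 h1, fun a ha H _ _ _ X hX => ?_⟩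
  refine summable_norm_scalarHomPart_and_tsum_le ha
    (fun _ => ⟨sub_nonneg.2 h1, by linarith⟩) (le_of_eq ?_) hX
  simp only [sub_sub_cancel, Finset.prod_const, Finset.card_univ, Fintype.card_fin]
  rw [← Real.rpow_natCast, ← Real.rpow_mul (by norm_num), one_div_mul_cancel hk0.ne',
    Real.rpow_one]

/-- The Bohr set is closed under suprema: the finite partial sums of `∑_p ‖φ_p(rY)‖` are
continuous in `r`. -/
theorem csSup_bohrSet_mem (hne : (bohrSet.{v} n).Nonempty) (hb : BddAbove (bohrSet.{v} n)) :
    sSup (bohrSet.{v} n) ∈ bohrSet.{v} n := by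
  have hcl := csSup_mem_closure hne hb
  set R := sSup (bohrSet.{v} n)
  have hR : 0 ≤ R := by
    obtain ⟨r, hr⟩ := hne
    exact hr.1.trans (le_csSup hb hr)
  refine ⟨hR, fun a ha H _ _ _ X hX => ?_⟩
  obtain ⟨Y, hY, rfl⟩ := hX
  simp only [norm_scalarHomPart_scale a fun _ => hR]
  have hfin (s : Finset (Fin k → ℕ)) :
      ∑ p ∈ s, (∏ i, R ^ p i) * ‖scalarHomPart a Y p‖ ≤ scalarSupNorm.{v} a := by
    refine closure_minimal (s := bohrSet.{v} n)
      (t := {r | ∑ p ∈ s, (∏ i, r ^ p i) * ‖scalarHomPart a Y p‖ ≤ scalarSupNorm.{v} a})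
      (fun r hr => ?_) (isClosed_le (by fun_prop) continuous_const) hcl
    obtain ⟨hs, hle⟩ := hr.2 a ha H _ ⟨Y, hY, rfl⟩
    refine le_trans ?_ hle
    simp only [norm_scalarHomPart_scale a fun _ => hr.1] at hs ⊢
    exact hs.sum_le_tsum s fun p _ =>
      mul_nonneg (Finset.prod_nonneg fun i _ => pow_nonneg hr.1 _) (norm_nonneg _)
  have hnn : ∀ p, 0 ≤ (∏ i, R ^ p i) * ‖scalarHomPart a Y p‖ := fun p =>
    mul_nonneg (Finset.prod_nonneg fun i _ => pow_nonneg hR _) (norm_nonneg _)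
  have hs := summable_of_sum_le hnn hfin
  exact ⟨hs, hs.tsum_le_of_sum_le hfin⟩

end Bohr

/-! ### Functions of a single entry of the tuple -/

section SingleEntry

variable {k : ℕ} {n : Fin k → ℕ} {H : Type v} [NormedAddCommGroup H] [InnerProductSpace ℂ H]

theorem prod_ofFn_mulSingle {M : Type*} [Monoid M] {m : ℕ} (i : Fin m) (x : M) :
    (List.ofFn (Pi.mulSingle i x : Fin m → M)).prod = x := by
  induction m with
  | zero => exact i.elim0
  | succ m ih =>
    rw [List.ofFn_succ, List.prod_cons]
    cases i using Fin.cases with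
    | zero =>
      have : (fun j : Fin m => (Pi.mulSingle 0 x : Fin (m + 1) → M) j.succ) = fun _ => 1 :=
        funext fun j => Pi.mulSingle_eq_of_ne (Fin.succ_ne_zero j) x
      rw [this, Pi.mulSingle_eq_same]
      simp
    | succ i =>
      have : (fun j : Fin m => (Pi.mulSingle i.succ x : Fin (m + 1) → M) j.succ) =
          Pi.mulSingle i x := by
        ext j
        simp [Pi.mulSingle_apply]
      rw [this, ih, Pi.mulSingle_eq_of_ne (Fin.succ_ne_zero i).symm, one_mul]

/-- The multi-word whose only nontrivial component is `g_j^m`, in position `i`. -/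
def powerWord (i : Fin k) (j : Fin (n i)) (m : ℕ) : MultiWord n :=
  Pi.mulSingle i (FreeMonoid.of j ^ m)

theorem wordEval_powerWord (X : OpTuple n H) (i : Fin k) (j : Fin (n i)) (m : ℕ) :
    wordEval X (powerWord i j m) = X i j ^ m := by
  have : (fun s : Fin k => FreeMonoid.lift (X s) (powerWord i j m s)) =
      Pi.mulSingle i (X i j ^ m) := by
    ext1 s
    rcases eq_or_ne s i with rfl | hs
    · simp [powerWord]
    · simp [powerWord, Pi.mulSingle_eq_of_ne hs]
  rw [wordEval, this, prod_ofFn_mulSingle]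

theorem length_powerWord (i : Fin k) (j : Fin (n i)) (m : ℕ) (s : Fin k) :
    (powerWord i j m s).length = (Pi.single i m : Fin k → ℕ) s := by
  rcases eq_or_ne s i with rfl | hs
  · simp only [powerWord, Pi.mulSingle_eq_same, Pi.single_eq_same]
    induction m with
    | zero => simp
    | succ m ih => rw [pow_succ, FreeMonoid.length_mul, ih, FreeMonoid.length_of]
  · simp [powerWord, Pi.mulSingle_eq_of_ne hs, Pi.single_eq_of_ne hs]

open Classical in
/-- The coefficients of the free holomorphic function `X ↦ ∑ b_m X_{i,j}^m`. -/
noncomputable def entryCoeff (i : Fin k) (j : Fin (n i)) (b : ℕ → ℂ) (α : MultiWord n) : ℂ :=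
  if α = powerWord i j (α i).length then b (α i).length else 0

theorem scalarHomPart_entryCoeff (i : Fin k) (j : Fin (n i)) (b : ℕ → ℂ) (X : OpTuple n H)
    (m : ℕ) : scalarHomPart (entryCoeff i j b) X (Pi.single i m) = b m • X i j ^ m := by
  rw [scalarHomPart, Finset.sum_eq_single (powerWord i j m), wordEval_powerWord]
  · have : (powerWord i j m i).length = m := by rw [length_powerWord, Pi.single_eq_same]
    rw [entryCoeff, this, if_pos rfl]
  · intro α hα hne
    have : (α i).length = m := by rw [mem_multiWordsFinset.1 hα, Pi.single_eq_same]
    rw [entryCoeff, this, if_neg hne, zero_smul]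
  · exact fun h => absurd (mem_multiWordsFinset.2 (length_powerWord i j m)) h

theorem scalarHomPart_entryCoeff_of_notMem (i : Fin k) (j : Fin (n i)) (b : ℕ → ℂ)
    (X : OpTuple n H) {p : Fin k → ℕ}
    (hp : p ∉ Set.range fun m : ℕ => (Pi.single i m : Fin k → ℕ)) :
    scalarHomPart (entryCoeff i j b) X p = 0 := by
  refine Finset.sum_eq_zero fun α hα => ?_
  rw [entryCoeff, if_neg, zero_smul]
  refine fun h => hp ⟨(α i).length, funext fun s => ?_⟩
  rw [← mem_multiWordsFinset.1 hα s]
  conv_rhs => rw [h]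
  exact (length_powerWord i j _ s).symm

/-- Only the multi-degrees `(0, …, m, …, 0)` contribute, so the multi-homogeneous expansion is the
power series in `X_{i,j}`. -/
theorem hasSum_scalarHomPart_entryCoeff {i : Fin k} {j : Fin (n i)} {b : ℕ → ℂ}
    {X : OpTuple n H} {V : H →L[ℂ] H} (h : HasSum (fun m => b m • X i j ^ m) V) :
    HasSum (fun p => scalarHomPart (entryCoeff i j b) X p) V := by
  have hinj : Function.Injective fun m : ℕ => (Pi.single i m : Fin k → ℕ) :=
    Pi.single_injective (M := fun _ => ℕ) i
  rw [← hinj.hasSum_iff fun p hp => scalarHomPart_entryCoeff_of_notMem i j b X hp]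
  exact h.congr_fun fun m => scalarHomPart_entryCoeff i j b X m

/-- An entry of a row is dominated by the row: `X_{i,j} X_{i,j}^* ≤ ∑_j X_{i,j} X_{i,j}^*`. -/
theorem norm_entry_lt_one [CompleteSpace H] {X : OpTuple n H} (hX : X ∈ regularPolyball n H)
    (i : Fin k) (j : Fin (n i)) : ‖X i j‖ < 1 := by
  have h := hX.2.1 i
  rw [Real.sqrt_lt' one_pos, one_pow] at h
  have h1 : ‖X i j * star (X i j)‖ ≤ ‖∑ j, X i j * star (X i j)‖ :=
    CStarAlgebra.norm_le_norm_of_nonneg_of_le (mul_star_self_nonneg _)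
      (Finset.single_le_sum (f := fun j => X i j * star (X i j))
        (fun j _ => mul_star_self_nonneg _) (Finset.mem_univ j))
  rw [CStarRing.norm_self_mul_star] at h1
  have h2 := h1.trans_lt h
  nlinarith [norm_nonneg (X i j)]

end SingleEntry

/-! ### Möbius functions and the upper bound for the Bohr radius -/

section Moebius

/-- The Taylor coefficients of the Möbius function `z ↦ (c - z) / (1 - c z)`. -/
def moebiusCoeff (c : ℝ) : ℕ → ℝ
  | 0 => c
  | m + 1 => -(1 - c ^ 2) * c ^ m

/-- Von Neumann's inequality for the Möbius function `(c - z) / (1 - c z)`: with `y = (1 - cZ)⁻¹ x`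
it reads `‖(c - Z) y‖ ≤ ‖(1 - c Z) y‖`, where the difference of the squares is
`(1 - c²) (‖y‖² - ‖Z y‖²)`. -/
theorem exists_hasSum_moebius {H : Type*} [NormedAddCommGroup H] [InnerProductSpace ℂ H]
    [CompleteSpace H] {c : ℝ} (hc0 : 0 ≤ c) (hc1 : c < 1) {Z : H →L[ℂ] H} (hZ : ‖Z‖ < 1) :
    ∃ V, HasSum (fun m => (moebiusCoeff c m : ℂ) • Z ^ m) V ∧ ‖V‖ ≤ 1 := by
  have hcZ : ‖(c : ℂ) • Z‖ < 1 := by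
    rw [norm_smul, Complex.norm_real, Real.norm_of_nonneg hc0]
    nlinarith [norm_nonneg Z]
  have hS := (summable_geometric_of_norm_lt_one hcZ).hasSum
  have hinv := mul_neg_geom_series ((c : ℂ) • Z) hcZ
  set S := ∑' m : ℕ, ((c : ℂ) • Z) ^ m
  refine ⟨(-(1 - c ^ 2 : ℝ) : ℂ) • (Z * S) + (c : ℂ) • 1, ?_, ?_⟩
  · have h1 := (hS.mul_left Z).const_smul (-(1 - c ^ 2 : ℝ) : ℂ)
    have h2 := (hasSum_nat_add_iff (f := fun m => (moebiusCoeff c m : ℂ) • Z ^ m) 1).1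
      (h1.congr_fun fun m => by
        simp only [moebiusCoeff, smul_pow, mul_smul_comm, smul_smul, pow_succ']
        push_cast
        rfl)
    simpa [moebiusCoeff] using h2
  · refine ContinuousLinearMap.opNorm_le_bound _ zero_le_one fun x => ?_
    set y := S x with hy
    have hx : x = y - (c : ℂ) • Z y := by
      have := congrArg (fun T : H →L[ℂ] H => T x) hinv
      simpa [sub_mul] using this.symm
    have hV : ((-(1 - c ^ 2 : ℝ) : ℂ) • (Z * S) + (c : ℂ) • 1) x = (c : ℂ) • y - Z y := by
      have : ((-(1 - c ^ 2 : ℝ) : ℂ) • (Z * S) + (c : ℂ) • 1) x =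
        (-(1 - c ^ 2 : ℝ) : ℂ) • Z y + (c : ℂ) • x := by simp [hy]
      rw [this, hx, smul_sub, smul_smul]
      push_cast
      module
    have hZy : ‖Z y‖ ≤ ‖y‖ :=
      (Z.le_of_opNorm_le hZ.le y).trans_eq (one_mul _)
    rw [one_mul, hV, hx]
    refine le_of_sq_le_sq ?_ (norm_nonneg _)
    have e1 : (inner ℂ ((c : ℂ) • y) (Z y)).re = c * (inner ℂ y (Z y)).re := by
      rw [inner_smul_left, Complex.conj_ofReal, Complex.re_ofReal_mul]
    have e2 : (inner ℂ y ((c : ℂ) • Z y)).re = c * (inner ℂ y (Z y)).re := by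
      rw [inner_smul_right, Complex.re_ofReal_mul]
    rw [norm_sub_sq (𝕜 := ℂ), norm_sub_sq (𝕜 := ℂ), RCLike.re_to_complex, RCLike.re_to_complex,
      e1, e2, norm_smul, norm_smul, Complex.norm_real, Real.norm_of_nonneg hc0]
    have h3 : ‖Z y‖ ^ 2 ≤ ‖y‖ ^ 2 := pow_le_pow_left₀ (norm_nonneg _) hZy 2
    have h4 : 0 ≤ 1 - c ^ 2 := by nlinarith
    nlinarith [mul_nonneg h4 (sub_nonneg.2 h3)]

theorem hasSum_abs_moebiusCoeff {c s : ℝ} (hc0 : 0 ≤ c) (hc1 : c < 1) (hs0 : 0 ≤ s)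
    (hs1 : s < 1) :
    HasSum (fun m => |moebiusCoeff c m| * s ^ m) ((1 - c ^ 2) * s * (1 - c * s)⁻¹ + c) := by
  have hcs : c * s < 1 := by nlinarith
  have h4 : 0 ≤ 1 - c ^ 2 := by nlinarith
  have h1 := (hasSum_geometric_of_lt_one (mul_nonneg hc0 hs0) hcs).mul_left ((1 - c ^ 2) * s)
  have h2 := (hasSum_nat_add_iff (f := fun m => |moebiusCoeff c m| * s ^ m) 1).1
    (h1.congr_fun fun m => by
      rw [moebiusCoeff, abs_mul, abs_neg, abs_of_nonneg h4, abs_of_nonneg (pow_nonneg hc0 m)]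
      ring)
  simpa [moebiusCoeff, abs_of_nonneg hc0] using h2

variable {k : ℕ} {n : Fin k → ℕ}

theorem moebius_mem_hardySpace (i : Fin k) (j : Fin (n i)) {c : ℝ} (hc0 : 0 ≤ c) (hc1 : c < 1) :
    (entryCoeff i j fun m => (moebiusCoeff c m : ℂ)) ∈ hardySpace.{v} n ∧
      scalarSupNorm.{v} (entryCoeff (n := n) i j fun m => (moebiusCoeff c m : ℂ)) ≤ 1 := by
  have hb : ∀ x ∈ scalarNormValues.{v} (entryCoeff (n := n) i j fun m => (moebiusCoeff c m : ℂ)),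
      x ≤ 1 := by
    rintro _ ⟨H, _, _, _, X, hX, rfl⟩
    obtain ⟨V, hV, hV1⟩ := exists_hasSum_moebius hc0 hc1 (norm_entry_lt_one hX i j)
    rwa [scalarValue, (hasSum_scalarHomPart_entryCoeff hV).tsum_eq]
  refine ⟨⟨fun H _ _ _ X hX => ?_, 1, hb⟩, Real.sSup_le hb zero_le_one⟩
  obtain ⟨V, hV, -⟩ := exists_hasSum_moebius hc0 hc1 (norm_entry_lt_one hX i j)
  exact (hasSum_scalarHomPart_entryCoeff hV).summable

/-- The Möbius function of `X_{i,j}`, evaluated at the scalar tuple with `X_{i,j} = s`, where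
`1/3 < s < r`, violates the Bohr inequality. Since `s < 1/2`, the series converges even when `r ≥ 1`. -/
theorem le_one_third_of_mem_bohrSet (i : Fin k) (j : Fin (n i)) {r : ℝ}
    (hr : r ∈ bohrSet.{v} n) : r ≤ 1 / 3 := by
  by_contra! hlt
  obtain ⟨s, hs3, hs⟩ := exists_between (lt_min hlt (by norm_num : (1 / 3 : ℝ) < 1 / 2))
  obtain ⟨hsr, hs2⟩ := lt_min_iff.1 hs
  have hs0 : 0 < s := by linarith
  have hr0 : 0 < r := hs0.trans hsr
  -- The parameter `c` is so close to `1` that `(1 + 2c) s > 1`.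
  obtain ⟨c, hc, hc1⟩ : ∃ c, (s⁻¹ - 1) / 2 < c ∧ c < 1 := by
    refine exists_between ?_
    have : s⁻¹ < (1 / 3)⁻¹ := inv_strictAnti₀ (by norm_num) hs3
    norm_num at this
    linarith
  have hsinv : s * s⁻¹ = 1 := mul_inv_cancel₀ hs0.ne'
  have hc0 : 0 ≤ c := by
    have : (1 / 2 : ℝ)⁻¹ < s⁻¹ := inv_strictAnti₀ hs0 hs2
    norm_num at this
    linarith
  have hc2 : 1 < (1 + 2 * c) * s := by nlinarith
  obtain ⟨hmem, hnorm⟩ := moebius_mem_hardySpace.{v} i j hc0 hc1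
  have ht : s / r < 1 := (div_lt_one hr0).2 hsr
  have ht0 : 0 ≤ s / r := by positivity
  let H := EuclideanSpace ℂ PUnit.{v + 1}
  let x : ∀ i, Fin (n i) → ℂ := Pi.single i (Pi.single j ((s / r : ℝ) : ℂ))
  have hx : ∀ i', ∑ j', ‖x i' j'‖ ^ 2 < 1 := by
    intro i'
    rcases eq_or_ne i' i with rfl | hi
    · simp only [x, Pi.single_eq_same]
      rw [Finset.sum_eq_single j]
      · rw [Pi.single_eq_same, Complex.norm_real, Real.norm_of_nonneg ht0]
        nlinarith
      · intro j' _ hj'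
        rw [Pi.single_eq_of_ne hj']; simp
      · simp
    · simp [x, Pi.single_eq_of_ne hi]
  obtain ⟨hsum, hle⟩ := hr.2 _ hmem H (scale (fun _ => r) (scalarTuple H x))
    ⟨_, subset_closure (scalarTuple_mem_regularPolyball hx), rfl⟩
  have hentry : scale (fun _ => r) (scalarTuple H x) i j = (s : ℂ) • 1 := by
    simp only [scale, scalarTuple, x, Pi.single_eq_same, smul_smul]
    congr 1
    rw [← Complex.ofReal_mul, mul_div_cancel₀ _ hr0.ne']
  have hinj : Function.Injective fun m : ℕ => (Pi.single i m : Fin k → ℕ) :=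
    Pi.single_injective (M := fun _ => ℕ) i
  have htot : HasSum (fun p => ‖scalarHomPart (entryCoeff i j fun m => (moebiusCoeff c m : ℂ))
      (scale (fun _ => r) (scalarTuple H x)) p‖) ((1 - c ^ 2) * s * (1 - c * s)⁻¹ + c) := by
    rw [← hinj.hasSum_iff fun p hp => by
      rw [scalarHomPart_entryCoeff_of_notMem i j _ _ hp, norm_zero]]
    refine (hasSum_abs_moebiusCoeff hc0 hc1 hs0.le (by linarith)).congr_fun fun m => ?_
    rw [Function.comp_apply, scalarHomPart_entryCoeff, hentry, smul_pow, one_pow, norm_smul,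
      norm_smul, norm_one, mul_one, norm_pow, Complex.norm_real, Complex.norm_real,
      Real.norm_eq_abs, Real.norm_of_nonneg hs0.le]
  rw [htot.tsum_eq] at hle
  have hcs : 0 < 1 - c * s := by nlinarith
  have h1 : (1 - c ^ 2) * s * (1 - c * s)⁻¹ ≤ 1 - c := by linarith [hle.trans hnorm]
  rw [← div_eq_mul_inv, div_le_iff₀ hcs] at h1
  -- `(1 - c) ((1 + 2c) s - 1) > 0` contradicts the Bohr inequality.
  nlinarith [mul_pos (sub_pos.2 hc1) (sub_pos.2 hc2)]

end Moebius

end Polyball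

theorem mainTheorem4 {k : ℕ} (hk : 1 ≤ k) (n : Fin k → ℕ) (hn : ∀ i, 1 ≤ n i) :
    (∀ (K : Type u) [NormedAddCommGroup K] [InnerProductSpace ℂ K] [CompleteSpace K] [Nontrivial K]
        (A : Polyball.MultiWord n → (K →L[ℂ] K)) (a₀ : ℂ),
      Polyball.IsBoundedFreeHolomorphic.{u, v} A →
      Polyball.supNorm.{u, v} A ≤ 1 →
      (∀ (H : Type v) [NormedAddCommGroup H] [InnerProductSpace ℂ H] [CompleteSpace H],
        Polyball.value A (0 : Polyball.OpTuple n H) = a₀ • 1) →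
      ∀ r : Fin k → ℝ, (∀ i, 0 ≤ r i ∧ r i < 1) →
      ∀ (H : Type v) [NormedAddCommGroup H] [InnerProductSpace ℂ H] [CompleteSpace H],
        ∀ X ∈ Polyball.scaledClosedPolyball n H r,
          Summable (fun p : Fin k → ℕ => ‖Polyball.homPart A X p‖) ∧
          ∑' p : Fin k → ℕ, ‖Polyball.homPart A X p‖
            ≤ ‖a₀‖ + (1 - ‖a₀‖ ^ 2) * ((∏ i, (1 - r i)⁻¹) - 1) ∧
          (2 / 3 ≤ ∏ i, (1 - r i) → ∑' p : Fin k → ℕ, ‖Polyball.homPart A X p‖ ≤ 1)) ∧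
    IsGreatest (Polyball.bohrSet.{v} n) (Polyball.bohrRadius.{v} n) ∧
    1 - (2 / 3 : ℝ) ^ (1 / (k : ℝ)) ≤ Polyball.bohrRadius.{v} n ∧
    Polyball.bohrRadius.{v} n ≤ 1 / 3 := by
  have hk0 : 0 < k := hk
  have hne := Polyball.one_sub_rpow_mem_bohrSet.{v} (n := n) hk
  have hub : ∀ r ∈ Polyball.bohrSet.{v} n, r ≤ 1 / 3 := fun r hr =>
    Polyball.le_one_third_of_mem_bohrSet ⟨0, hk0⟩ ⟨0, hn _⟩ hr
  have hb : BddAbove (Polyball.bohrSet.{v} n) := ⟨_, hub⟩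
  refine ⟨?_, ⟨Polyball.csSup_bohrSet_mem ⟨_, hne⟩ hb, fun r hr => le_csSup hb hr⟩,
    le_csSup hb hne, csSup_le ⟨_, hne⟩ hub⟩
  intro K _ _ _ _ A a₀ hA hA1 h0 r hr H _ _ _ X hX
  obtain ⟨hs, hle⟩ := Polyball.summable_norm_homPart_and_tsum_le hA hA1 h0 hr hX
  refine ⟨hs, hle, fun hr' => hle.trans ?_⟩
  have ha₀ : ‖a₀‖ ≤ 1 := (Polyball.norm_value_zero_le hA h0).trans hA1
  have hprod := Polyball.prod_inv_sub_one_le hr'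
  have hD : 0 ≤ 1 - ‖a₀‖ ^ 2 := by nlinarith [norm_nonneg a₀]
  -- `|a₀| + (1 - |a₀|²) / 2 ≤ 1` is `(1 - |a₀|)² ≥ 0`.
  nlinarith [mul_le_mul_of_nonneg_left hprod hD, sq_nonneg (1 - ‖a₀‖)]
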